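/- Let $M$ be a nonempty smooth $4$-manifold with a smooth global frame $X_1,\dots,X_4$ satisfying $$[X_1,X_2]=-X_3,\quad [X_1,X_3]=-X_2,\quad [X_2,X_3]=X_4,\quad [X_i,X_4]=0 ,$$ (the Lie algebra $U3I0$; e.g. the left-invariant frame on the corresponding Lie group or on a compact quotient of it by a discrete subgroup). For $a=(a_1,a_3,a_6)\in\mathbb R^3$ let $\alpha(a)=(Y_1,\dots,Y_4)$ be the frame $$Y_1=X_1-a_3X_2+a_1X_3+a_6X_4,\quad Y_2=X_2+a_3X_4,\quad Y_3=X_3+a_1X_4,\quad Y_4=X_4 ,$$ with dual coframe $\omega^1,\dots,\omega^4$. For $\lambda\in(0,\infty)^4$, an A7i flow with frame $\alpha(a)$ and initial data $\lambda$ is a family $g(t)$, $t\ge 0$, of Riemannian metrics on $M$ with constant components in $\alpha(a)$, such that $g(t)$ and its Ricci tensor are diagonal in $\alpha(a)$ for all $t\ge0$, $\partial_t g=-2\,\mathrm{Rc}(g)$, and $g(0)=\sum_i\lambda_i\,\omega^i\otimes\omega^i$. Write $\bar g\in[g]$ ($\bar g$ quasi-converges to $g$) if for every $\epsilon>0$ there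 is $t_\epsilon$ with $\sup_{M\times[t_\epsilon,\infty)}|\bar g-g|_g<\epsilon$. Theorem 8.1. For all $a\in\mathbb R^3$ and $\lambda\in(0,\infty)^4$ there is exactly one A7i flow with frame $\alpha(a)$ and initial data $\lambda$. Let $g$ be an A7i flow with frame $\alpha(a)$ and initial data $\lambda$. (1) If $\bar g$ is an A7i flow with frame $\alpha(\bar a)$ (possibly different from $\alpha(a)$) and initial data $\bar\lambda$, then $$\bar g\in[g]\iff \bar\lambda_2\bar\lambda_3\bar\lambda_4^2=\lambda_2\lambda_3\lambda_4^2 .$$ (2) In each frame of the family, the class $[g]$ is exactly a $3$-parameter family: for every $\bar a\in\mathbb R^3$ and all $\bar\lambda_1,\bar\lambda_2,\bar\lambda_4>0$ there is exactly one $\bar\lambda_3>0$ for which there is an A7i flow $\bar g\in[g]$ with frame $\alpha(\bar a)$ and initial data $(\bar\lambda_1,\bar\lambda_2,\bar\lambda_3,\bar\lambda_4)$, and this $\bar g$ is unique. -/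

import Mathlib

open scoped Manifold ContDiff

noncomputable section

namespace RicciU3I0

variable {M : Type*} [TopologicalSpace M] [ChartedSpace (EuclideanSpace ℝ (Fin 4)) M]

variable (M) in
/-- A (not necessarily continuous) vector field on the 4-manifold `M`. -/
abbrev VField : Type _ := (p : M) → TangentSpace (𝓡 4) p

variable (M) in
/-- A (not necessarily continuous) covariant 2-tensor field on the 4-manifold `M`. -/
abbrev TwoTensor : Type _ :=
  (p : M) → TangentSpace (𝓡 4) p →ₗ[ℝ] TangentSpace (𝓡 4) p →ₗ[ℝ] ℝ

/-- `X` is a smooth global frame of the 4-manifold `M`. -/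
structure IsSmoothFrame [IsManifold (𝓡 4) ∞ M] (X : Fin 4 → VField M) : Prop where
  smooth : ∀ i, ContMDiff (𝓡 4) (𝓡 4).tangent ∞
    (fun p => (⟨p, X i p⟩ : TangentBundle (𝓡 4) M))
  linearIndependent : ∀ p, LinearIndependent ℝ (fun i => X i p)

/-- `X` is a smooth global frame with the brackets of the unimodular Lie algebra `U3I0`:
`[X₁,X₂] = -X₃`, `[X₁,X₃] = -X₂`, `[X₂,X₃] = X₄` and `X₄` central (the indices here start at `0`).
On the Lie group with this Lie algebra, and on its quotients by discrete subgroups, such a frame is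
given by left-invariant vector fields. -/
structure IsU3I0Frame [IsManifold (𝓡 4) ∞ M] (X : Fin 4 → VField M) : Prop extends IsSmoothFrame X where
  bracket_01 : ∀ p, VectorField.mlieBracket (𝓡 4) (X 0) (X 1) p = -X 2 p
  bracket_02 : ∀ p, VectorField.mlieBracket (𝓡 4) (X 0) (X 2) p = -X 1 p
  bracket_12 : ∀ p, VectorField.mlieBracket (𝓡 4) (X 1) (X 2) p = X 3 p
  bracket_03 : ∀ p, VectorField.mlieBracket (𝓡 4) (X 0) (X 3) p = 0
  bracket_13 : ∀ p, VectorField.mlieBracket (𝓡 4) (X 1) (X 3) p = 0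
  bracket_23 : ∀ p, VectorField.mlieBracket (𝓡 4) (X 2) (X 3) p = 0

/-- The component matrix `g(Yᵢ, Yⱼ)` of a 2-tensor field in a frame. -/
def comp (Y : Fin 4 → VField M) (g : TwoTensor M) (p : M) : Matrix (Fin 4) (Fin 4) ℝ :=
  Matrix.of fun i j => g p (Y i p) (Y j p)

/-- The derivative `Yᵢ(f)` of a function along a frame field. -/
def along (Y : Fin 4 → VField M) (i : Fin 4) (f : M → ℝ) (p : M) : ℝ :=
  mvfderiv (𝓡 4) f p (Y i p)

/-- `g([Yᵢ, Yⱼ], Yₖ)`. -/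
def bracketComp (Y : Fin 4 → VField M) (g : TwoTensor M) (i j k : Fin 4) (p : M) : ℝ :=
  g p (VectorField.mlieBracket (𝓡 4) (Y i) (Y j) p) (Y k p)

/-- `g(∇_{Yᵢ} Yⱼ, Yₖ)` for the Levi-Civita connection `∇` of the metric `g`, by the
Koszul formula. -/
def koszul (Y : Fin 4 → VField M) (g : TwoTensor M) (i j k : Fin 4) (p : M) : ℝ :=
  (along Y i (fun q => comp Y g q j k) p + along Y j (fun q => comp Y g q i k) p
    - along Y k (fun q => comp Y g q i j) p
    + bracketComp Y g i j k p - bracketComp Y g i k j p - bracketComp Y g j k i p) / 2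

/-- The connection coefficients `Γ`: `∇_{Yᵢ} Yⱼ = ∑ₗ Γ i j l • Yₗ`. -/
def connCoeff (Y : Fin 4 → VField M) (g : TwoTensor M) (i j l : Fin 4) (p : M) : ℝ :=
  ∑ k, (comp Y g p)⁻¹ l k * koszul Y g i j k p

/-- The structure functions `c`: `[Yᵢ, Yⱼ] = ∑ₗ c i j l • Yₗ`. -/
def structCoeff (Y : Fin 4 → VField M) (g : TwoTensor M) (i j l : Fin 4) (p : M) : ℝ :=
  ∑ k, (comp Y g p)⁻¹ l k * bracketComp Y g i j k p

/-- The components of the Riemann curvature tensor: `R(Yᵢ, Yⱼ) Yₖ = ∑ₗ (riemann i j k l) • Yₗ`,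
where `R(U, V) W = ∇_U ∇_V W - ∇_V ∇_U W - ∇_{[U,V]} W`. -/
def riemann (Y : Fin 4 → VField M) (g : TwoTensor M) (i j k l : Fin 4) (p : M) : ℝ :=
  along Y i (connCoeff Y g j k l) p - along Y j (connCoeff Y g i k l) p
    + ∑ m, (connCoeff Y g j k m p * connCoeff Y g i m l p
        - connCoeff Y g i k m p * connCoeff Y g j m l p
        - structCoeff Y g i j m p * connCoeff Y g m k l p)

/-- The components `Rc(Yᵢ, Yⱼ)` of the Ricci tensor of `g`, where `Rc(V, W)` is the trace
of `U ↦ R(U, V) W`. -/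
def ricci (Y : Fin 4 → VField M) (g : TwoTensor M) (i j : Fin 4) (p : M) : ℝ :=
  ∑ k, riemann Y g k i j k p

/-- `g` is symmetric and positive definite at each point. -/
def IsMetric (g : TwoTensor M) : Prop :=
  ∀ p, (∀ v w, g p v w = g p w v) ∧ ∀ v, v ≠ 0 → 0 < g p v v

/-- The frame `Yᵢ = Λᵢᵏ Xₖ`. -/
def changeFrame (L : Matrix (Fin 4) (Fin 4) ℝ) (X : Fin 4 → VField M) : Fin 4 → VField M :=
  fun i p => ∑ k, L i k • X k p

/-- The transition matrices of the frames that diagonalize the metrics of type `A7i`. -/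
def transition (a₁ a₃ a₆ : ℝ) : Matrix (Fin 4) (Fin 4) ℝ :=
  !![1, -a₃, a₁, a₆;
     0, 1, 0, a₃;
     0, 0, 1, a₁;
     0, 0, 0, 1]

/-- `g` has constant components in the frame `Y` (a left-invariant metric, if `Y` consists of
left-invariant fields; such a `g` is smooth, since `Y` is). -/
def IsHomogeneous (Y : Fin 4 → VField M) (g : TwoTensor M) : Prop :=
  ∀ p q, comp Y g p = comp Y g q

/-- The metric `g` and its Ricci tensor are both diagonal in the frame `Y`. -/
def IsDiagonal (Y : Fin 4 → VField M) (g : TwoTensor M) : Prop :=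
  ∀ p, ∀ i j, i ≠ j → comp Y g p i j = 0 ∧ ricci Y g i j p = 0

/-- The family `g t`, `t ≥ 0`, solves the Ricci flow `∂g/∂t = -2 Rc`; the equation between tensors
is written in components in the frame `Y`. -/
def IsRicciFlow (Y : Fin 4 → VField M) (g : ℝ → TwoTensor M) : Prop :=
  ∀ t, 0 ≤ t → ∀ p i j,
    HasDerivWithinAt (fun s => comp Y (g s) p i j) (-2 * ricci Y (g t) i j p) (Set.Ici 0) t

/-- `g` is a Ricci flow, for all times `t ≥ 0`, of homogeneous metrics which are diagonal in the
frame `Y`, and `g 0 = l₁ ω¹⊗ω¹ + l₂ ω²⊗ω² + l₃ ω³⊗ω³ + l₄ ω⁴⊗ω⁴` with `ω` the coframe dual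
to `Y`. -/
structure IsDiagonalFlow (Y : Fin 4 → VField M) (l : Fin 4 → ℝ) (g : ℝ → TwoTensor M) :
    Prop where
  metric : ∀ t, 0 ≤ t → IsMetric (g t)
  homogeneous : ∀ t, 0 ≤ t → IsHomogeneous Y (g t)
  diagonal : ∀ t, 0 ≤ t → IsDiagonal Y (g t)
  ricciFlow : IsRicciFlow Y g
  initial : ∀ p, comp Y (g 0) p = Matrix.diagonal l

/-- The norm at `p`, with respect to the metric `h`, of a 2-tensor `T`:
`|T|_h² = hⁱᵏ hʲˡ Tᵢⱼ Tₖₗ`, computed in the frame `X` (the value is the same in every frame). -/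
def tensorNorm (X : Fin 4 → VField M) (h T : TwoTensor M) (p : M) : ℝ :=
  Real.sqrt (∑ i, ∑ j, ∑ k, ∑ l,
    (comp X h p)⁻¹ i k * (comp X h p)⁻¹ j l * comp X T p i j * comp X T p k l)

/-- The evolving metric `g` quasi-converges to the evolving metric `h`, i.e. `g ∈ [h]`: for
every `ε > 0` there is a time `T` with `|g - h|_h < ε` on `M × [T, ∞)`. -/
def QuasiConverges (X : Fin 4 → VField M) (g h : ℝ → TwoTensor M) : Prop :=
  ∀ ε > 0, ∃ T ≥ 0, ∀ t ≥ T, ∀ p : M, tensorNorm X (h t) (g t - h t) p < ε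

end RicciU3I0

end

/-!
The transition matrices are automorphisms of the Lie algebra `U3I0`
(`IsU3I0Frame.changeFrame_transition`), so every frame of the family has the same structure
constants, and a metric that is diagonal with constant components `A, B, C, D` in such a frame has
a diagonal Ricci tensor (`IsU3I0Frame.ricci_eq`). The flow is therefore the system

`A' = (B + C)² / (BC)`, `B' = (C² - B²) / (AC) + D / C`, `C' = (B² - C²) / (AB) + D / B`,
`D' = -D² / (BC)`.

It is integrable: `K = B C D²` and `S = A (B - C) / (2 √(BC))` are conserved, `D⁻³` is affine in
time with slope `3 / K`, and `A - S arctan (A / S)` is affine in time with slope `4`. These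
quantities determine the solution (`IsDiagSol.unique`) and, solved for the components, they give
one for all times (`isDiagSol_sol`).

As `t → ∞`, the formulas give `A ~ 4 t`, `D ~ δ t^(-1/3)` and `B ~ C ~ (√K / δ) t^(1/3)` with
`δ = (K / 3)^(1/3)`, so that the leading coefficients depend on `K` alone (`tendsto_sol`). For two
flows in different frames, the transition matrix between the frames is unipotent and only adds
to a component multiples of components with a slower growth, so it has no influence on the limit
(`tendsto_transition_weight`). Hence the norm of the difference of two flows converges, and its
limit vanishes exactly when the two values of `K` agree (`quasiConverges_iff`). Given `λ₁, λ₂, λ₄`,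
the equation `λ₂ λ₃ λ₄² = K` has exactly one solution `λ₃`. (Here
`λ₁, …, λ₄` are the components with the indices `0, …, 3` of `Fin 4`.)
-/

open scoped Manifold ContDiff

noncomputable section

namespace RicciU3I0

variable {M : Type*} [TopologicalSpace M] [ChartedSpace (EuclideanSpace ℝ (Fin 4)) M]

/-! ### Change of frame -/

theorem comp_changeFrame (L : Matrix (Fin 4) (Fin 4) ℝ) (X : Fin 4 → VField M) (g : TwoTensor M)
    (p : M) : comp (changeFrame L X) g p = L * comp X g p * L.transpose := by
  ext i j
  simp only [comp, changeFrame, Matrix.of_apply, Matrix.mul_apply, Matrix.transpose_apply,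
    map_sum, map_smul, LinearMap.sum_apply, LinearMap.smul_apply, smul_eq_mul, Finset.sum_mul]
  refine Finset.sum_congr rfl fun k _ => ?_
  refine (Finset.mul_sum _ _ _).trans (Finset.sum_congr rfl fun l _ => by ring)

theorem changeFrame_mul (A B : Matrix (Fin 4) (Fin 4) ℝ) (X : Fin 4 → VField M) :
    changeFrame (A * B) X = changeFrame A (changeFrame B X) := by
  ext1 i
  funext p
  simp only [changeFrame, Matrix.mul_apply, Finset.sum_smul, Finset.smul_sum, smul_smul]
  exact Finset.sum_comm

theorem transition_mul (a₁ a₃ a₆ b₁ b₃ b₆ : ℝ) :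
    transition a₁ a₃ a₆ * transition b₁ b₃ b₆ =
      transition (a₁ + b₁) (a₃ + b₃) (a₆ + b₆ - a₃ * b₃ + a₁ * b₁) := by
  ext i j
  fin_cases i <;> fin_cases j <;>
    simp [transition, Matrix.mul_apply, Fin.sum_univ_four] <;> ring

theorem det_transition (a₁ a₃ a₆ : ℝ) : (transition a₁ a₃ a₆).det = 1 := by
  rw [Matrix.det_of_isUpperTriangular]
  · simp [transition, Fin.prod_univ_four]
  · intro i j h
    fin_cases i <;> fin_cases j <;> simp_all [transition]

theorem linearIndependent_changeFrame {L : Matrix (Fin 4) (Fin 4) ℝ} (hL : IsUnit L.det)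
    {X : Fin 4 → VField M} {p : M} (hX : LinearIndependent ℝ fun i => X i p) :
    LinearIndependent ℝ fun i => changeFrame L X i p := by
  rw [Fintype.linearIndependent_iff] at hX ⊢
  intro c hc
  have h1 : Matrix.vecMul c L = 0 := by
    funext k
    refine hX (Matrix.vecMul c L) ?_ k
    rw [← hc]
    simp only [changeFrame, Matrix.vecMul, dotProduct, Finset.sum_smul, Finset.smul_sum, smul_smul]
    exact Finset.sum_comm
  have h2 : Matrix.vecMul (Matrix.vecMul c L) L⁻¹ = c := by
    rw [Matrix.vecMul_vecMul, Matrix.mul_nonsing_inv _ hL, Matrix.vecMul_one]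
  intro i
  rw [← h2, h1, Matrix.zero_vecMul, Pi.zero_apply]

/-- The basis of the tangent space at `p` given by a frame. -/
def frameBasis {Y : Fin 4 → VField M} {p : M} (hY : LinearIndependent ℝ fun i => Y i p) :
    Module.Basis (Fin 4) ℝ (TangentSpace (𝓡 4) p) :=
  basisOfLinearIndependentOfCardEqFinrank hY
    (show Fintype.card (Fin 4) = Module.finrank ℝ (EuclideanSpace ℝ (Fin 4)) by simp)

@[simp]
theorem frameBasis_apply {Y : Fin 4 → VField M} {p : M}
    (hY : LinearIndependent ℝ fun i => Y i p) (i : Fin 4) : frameBasis hY i = Y i p :=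
  congrFun (coe_basisOfLinearIndependentOfCardEqFinrank hY
    (show Fintype.card (Fin 4) = Module.finrank ℝ (EuclideanSpace ℝ (Fin 4)) by simp)) i

/-- Two 2-tensors with the same components in a frame agree. -/
theorem eq_of_comp_eq {Y : Fin 4 → VField M} (hY : ∀ p, LinearIndependent ℝ fun i => Y i p)
    {g h : TwoTensor M} (hgh : ∀ p, comp Y g p = comp Y h p) : g = h := by
  funext p
  refine (frameBasis (hY p)).ext fun i => (frameBasis (hY p)).ext fun j => ?_
  simpa [comp] using congrFun (congrFun (hgh p) i) j

/-- The 2-tensor with given constant components in a frame. -/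
def ofComp {Y : Fin 4 → VField M} (hY : ∀ p, LinearIndependent ℝ fun i => Y i p)
    (G : Matrix (Fin 4) (Fin 4) ℝ) : TwoTensor M := fun p =>
  Matrix.toLinearMap₂ (frameBasis (hY p)) (frameBasis (hY p)) G

theorem comp_ofComp {Y : Fin 4 → VField M} (hY : ∀ p, LinearIndependent ℝ fun i => Y i p)
    (G : Matrix (Fin 4) (Fin 4) ℝ) (p : M) : comp Y (ofComp hY G) p = G := by
  ext i j
  have h := Matrix.toLinearMap₂_apply_basis (frameBasis (hY p)) (frameBasis (hY p)) G i j
  rwa [frameBasis_apply, frameBasis_apply] at h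

theorem apply_eq_sum_of_comp_eq_diagonal {Y : Fin 4 → VField M} {p : M}
    (hY : LinearIndependent ℝ fun i => Y i p) {g : TwoTensor M} {d : Fin 4 → ℝ}
    (hg : comp Y g p = Matrix.diagonal d) (v w : TangentSpace (𝓡 4) p) :
    g p v w = ∑ i, d i * ((frameBasis hY).repr v i * (frameBasis hY).repr w i) := by
  have hg' : ∀ i j, g p (Y i p) (Y j p) = Matrix.diagonal d i j := fun i j =>
    congrFun (congrFun hg i) j
  conv_lhs => rw [← (frameBasis hY).sum_repr v, ← (frameBasis hY).sum_repr w]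
  simp only [map_sum, map_smul, LinearMap.sum_apply, LinearMap.smul_apply, frameBasis_apply, hg',
    Matrix.diagonal_apply, smul_eq_mul, mul_ite, mul_zero]
  refine Finset.sum_congr rfl fun i _ => ?_
  simp only [Finset.sum_ite_eq', Finset.mem_univ, if_true]
  ring

/-- A 2-tensor that is diagonal with positive entries in a frame is a metric. -/
theorem isMetric_of_comp_eq_diagonal {Y : Fin 4 → VField M}
    (hY : ∀ p, LinearIndependent ℝ fun i => Y i p) {g : TwoTensor M} {d : Fin 4 → ℝ}
    (hd : ∀ i, 0 < d i) (hg : ∀ p, comp Y g p = Matrix.diagonal d) : IsMetric g := by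
  intro p
  have key := apply_eq_sum_of_comp_eq_diagonal (hY p) (hg p)
  refine ⟨fun v w => ?_, fun v hv => ?_⟩
  · rw [key, key]
    exact Finset.sum_congr rfl fun i _ => by ring
  · rw [key]
    have : ∃ i, (frameBasis (hY p)).repr v i ≠ 0 := by
      by_contra! h
      exact hv ((frameBasis (hY p)).repr.map_eq_zero_iff.1 (Finsupp.ext h))
    obtain ⟨i, hi⟩ := this
    exact Finset.sum_pos' (fun j _ => mul_nonneg (hd j).le (mul_self_nonneg _))
      ⟨i, Finset.mem_univ _, mul_pos (hd i) (mul_self_pos.2 hi)⟩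

section
variable [IsManifold (𝓡 4) ∞ M]

theorem contMDiff_changeFrame (L : Matrix (Fin 4) (Fin 4) ℝ) {X : Fin 4 → VField M}
    (hX : ∀ i, ContMDiff (𝓡 4) (𝓡 4).tangent ∞
      (fun p => (⟨p, X i p⟩ : TangentBundle (𝓡 4) M))) (i : Fin 4) :
    ContMDiff (𝓡 4) (𝓡 4).tangent ∞
      (fun p => (⟨p, changeFrame L X i p⟩ : TangentBundle (𝓡 4) M)) := by
  have h := ContMDiff.sum_section (I := 𝓡 4) (n := ∞) (s := Finset.univ)
    (t := fun k p => L i k • X k p)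
    (fun k _ => (hX k).const_smul_section (a := L i k))
  exact h

theorem mlieBracket_sum_smul_left {ι : Type*} (s : Finset ι) (c : ι → ℝ) (V : ι → VField M)
    (W : VField M) (p : M)
    (hV : ∀ i, MDifferentiable (𝓡 4) (𝓡 4).tangent
      (fun p => (⟨p, V i p⟩ : TangentBundle (𝓡 4) M))) :
    VectorField.mlieBracket (𝓡 4) (∑ i ∈ s, c i • V i) W p =
      ∑ i ∈ s, c i • VectorField.mlieBracket (𝓡 4) (V i) W p := by
  classical
  induction s using Finset.induction_on with
  | empty => simp
  | insert a s ha ih =>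
    rw [Finset.sum_insert ha, Finset.sum_insert ha, VectorField.mlieBracket_add_left,
      VectorField.mlieBracket_const_smul_left (hV a p), ih]
    · exact (mdifferentiable_smul_const_section (a := c a) (hV a)) p
    · have h := MDifferentiable.sum_section (I := 𝓡 4) (s := s)
        (t := fun k p => c k • V k p)
        (fun k _ => mdifferentiable_smul_const_section (a := c k) (hV k))
      convert h p using 3
      simp

theorem mlieBracket_changeFrame (L : Matrix (Fin 4) (Fin 4) ℝ) {X : Fin 4 → VField M}
    (hX : ∀ i, ContMDiff (𝓡 4) (𝓡 4).tangent ∞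
      (fun p => (⟨p, X i p⟩ : TangentBundle (𝓡 4) M))) (i j : Fin 4) (p : M) :
    VectorField.mlieBracket (𝓡 4) (changeFrame L X i) (changeFrame L X j) p =
      ∑ k, ∑ l, (L i k * L j l) • VectorField.mlieBracket (𝓡 4) (X k) (X l) p := by
  have hd : ∀ i, MDifferentiable (𝓡 4) (𝓡 4).tangent
      (fun p => (⟨p, X i p⟩ : TangentBundle (𝓡 4) M)) := fun i =>
    (hX i).mdifferentiable (by simp)
  have hL : ∀ i, changeFrame L X i = ∑ k, L i k • X k := fun i => by
    funext p
    simp [changeFrame]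
  rw [hL i, mlieBracket_sum_smul_left _ _ _ _ _ hd]
  refine Finset.sum_congr rfl fun k _ => ?_
  rw [VectorField.mlieBracket_swap_apply, hL j, mlieBracket_sum_smul_left _ _ _ _ _ hd,
    ← Finset.sum_neg_distrib, Finset.smul_sum]
  refine Finset.sum_congr rfl fun l _ => ?_
  rw [← smul_neg, ← VectorField.mlieBracket_swap_apply, smul_smul]

/-- The structure constants of `U3I0`: `[Xᵢ, Xⱼ] = ∑ₗ structConst i j l • Xₗ`. -/
def structConst : Fin 4 → Fin 4 → Fin 4 → ℝ :=
  ![![0, ![0, 0, -1, 0], ![0, -1, 0, 0], 0],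
    ![![0, 0, 1, 0], 0, ![0, 0, 0, 1], 0],
    ![![0, 1, 0, 0], ![0, 0, 0, -1], 0, 0],
    ![0, 0, 0, 0]]

theorem IsU3I0Frame.mlieBracket_eq {X : Fin 4 → VField M} (hX : IsU3I0Frame X) (i j : Fin 4)
    (p : M) : VectorField.mlieBracket (𝓡 4) (X i) (X j) p = ∑ l, structConst i j l • X l p := by
  have h01 := hX.bracket_01 p
  have h02 := hX.bracket_02 p
  have h12 := hX.bracket_12 p
  have h03 := hX.bracket_03 p
  have h13 := hX.bracket_13 p
  have h23 := hX.bracket_23 p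
  have sw : ∀ i j, VectorField.mlieBracket (𝓡 4) (X i) (X j) p =
      -VectorField.mlieBracket (𝓡 4) (X j) (X i) p := fun i j =>
    VectorField.mlieBracket_swap_apply
  fin_cases i <;> fin_cases j <;> simp [structConst, Fin.sum_univ_four, h01, h02, h12, h03, h13,
    h23, sw 1 0, sw 2 0, sw 2 1, sw 3 0, sw 3 1, sw 3 2]

/-- The transition matrices are automorphisms of the Lie algebra `U3I0`. -/
theorem IsU3I0Frame.changeFrame_transition {X : Fin 4 → VField M} (hX : IsU3I0Frame X)
    (a₁ a₃ a₆ : ℝ) : IsU3I0Frame (changeFrame (transition a₁ a₃ a₆) X) := by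
  have key := fun i j p => mlieBracket_changeFrame (transition a₁ a₃ a₆) hX.smooth i j p
  refine ⟨⟨contMDiff_changeFrame _ hX.smooth, fun p => linearIndependent_changeFrame
    (by simp [det_transition]) (hX.linearIndependent p)⟩, ?_, ?_, ?_, ?_, ?_, ?_⟩ <;> intro p <;>
    rw [key] <;>
    simp only [hX.mlieBracket_eq, changeFrame, transition, structConst, Fin.sum_univ_four] <;>
    simp <;> try module

end

/-! ### Ricci curvature of diagonal metrics -/

theorem inv_diagonal {d : Fin 4 → ℝ} (hd : ∀ i, d i ≠ 0) :
    (Matrix.diagonal d)⁻¹ = Matrix.diagonal fun i => (d i)⁻¹ := by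
  refine Matrix.inv_eq_right_inv ?_
  rw [Matrix.diagonal_mul_diagonal, ← Matrix.diagonal_one]
  congr 1
  funext i
  exact mul_inv_cancel₀ (hd i)

theorem along_const (Y : Fin 4 → VField M) (i : Fin 4) (c : ℝ) (p : M) :
    along Y i (fun _ => c) p = 0 := by
  simp [along, mvfderiv_const]

/-- The diagonal components, in a `U3I0` frame, of the Ricci tensor of the metric
`diagonal d`. -/
def ricciDiag (d : Fin 4 → ℝ) : Fin 4 → ℝ :=
  ![-(d 1 + d 2) ^ 2 / (2 * (d 1 * d 2)),
    (d 1 ^ 2 - d 2 ^ 2) / (2 * (d 0 * d 2)) - d 3 / (2 * d 2),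
    (d 2 ^ 2 - d 1 ^ 2) / (2 * (d 0 * d 1)) - d 3 / (2 * d 1),
    d 3 ^ 2 / (2 * (d 1 * d 2))]

/-- The connection coefficients of the metric `diagonal d` in a `U3I0` frame. -/
def connDiag (d : Fin 4 → ℝ) (i j l : Fin 4) : ℝ :=
  (structConst i j l * d l - structConst i l j * d j - structConst j l i * d i) / (2 * d l)

theorem ricci_connDiag {d : Fin 4 → ℝ} (hd : ∀ i, d i ≠ 0) (i j : Fin 4) :
    ∑ k, ∑ m, (connDiag d i j m * connDiag d k m k - connDiag d k j m * connDiag d i m k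
      - structConst k i m * connDiag d m j k) = Matrix.diagonal (ricciDiag d) i j := by
  have h0 := hd 0
  have h1 := hd 1
  have h2 := hd 2
  have h3 := hd 3
  fin_cases i <;> fin_cases j <;>
    simp [Fin.sum_univ_four, connDiag, structConst, ricciDiag] <;>
    field_simp <;> ring

section
variable [IsManifold (𝓡 4) ∞ M]

/-- A metric which is diagonal with constant components in a `U3I0` frame has a Ricci tensor which
is diagonal with constant components. -/
theorem IsU3I0Frame.ricci_eq {Y : Fin 4 → VField M} (hY : IsU3I0Frame Y) {g : TwoTensor M}
    {d : Fin 4 → ℝ} (hd : ∀ i, d i ≠ 0) (hg : ∀ p, comp Y g p = Matrix.diagonal d)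
    (i j : Fin 4) (p : M) : ricci Y g i j p = Matrix.diagonal (ricciDiag d) i j := by
  have hinv := inv_diagonal hd
  have hbr : ∀ i j k p, bracketComp Y g i j k p = structConst i j k * d k := by
    intro i j k p
    have hg' : ∀ i j, g p (Y i p) (Y j p) = Matrix.diagonal d i j := fun i j =>
      congrFun (congrFun (hg p) i) j
    simp [bracketComp, hY.mlieBracket_eq, hg', Matrix.diagonal_apply]
  have hko : ∀ i j k p, koszul Y g i j k p = (structConst i j k * d k - structConst i k j * d j
      - structConst j k i * d i) / 2 := by
    intro i j k p
    simp [koszul, hbr, hg, along_const]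
  have hco : ∀ i j l, connCoeff Y g i j l = fun _ => connDiag d i j l := by
    intro i j l
    funext p
    simp only [connCoeff, hg, hinv, hko, Matrix.diagonal_apply, ite_mul, zero_mul,
      Finset.sum_ite_eq, Finset.mem_univ, if_true, connDiag]
    have := hd l
    field_simp
  have hst : ∀ i j l, structCoeff Y g i j l p = structConst i j l := by
    intro i j l
    simp only [structCoeff, hg, hinv, hbr, Matrix.diagonal_apply, ite_mul, zero_mul,
      Finset.sum_ite_eq, Finset.mem_univ, if_true]
    have := hd l
    field_simp
  simp only [ricci, riemann, hco, hst, along_const, sub_zero, zero_add]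
  exact ricci_connDiag hd i j

/-! ### Reduction to an ordinary differential equation -/

/-- The Ricci flow equation for the diagonal components of the metric in a `U3I0` frame, on
`[0, ∞)`, together with positivity and the initial condition. -/
structure IsDiagSol (l : Fin 4 → ℝ) (d : ℝ → Fin 4 → ℝ) : Prop where
  pos : ∀ t, 0 ≤ t → ∀ i, 0 < d t i
  initial : d 0 = l
  deriv : ∀ t, 0 ≤ t → ∀ i,
    HasDerivWithinAt (fun s => d s i) (-2 * ricciDiag (d t) i) (Set.Ici 0) t

theorem IsDiagonalFlow.exists_isDiagSol [Nonempty M] {Y : Fin 4 → VField M} (hY : IsU3I0Frame Y)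
    {l : Fin 4 → ℝ} {g : ℝ → TwoTensor M} (h : IsDiagonalFlow Y l g) :
    ∃ d, IsDiagSol l d ∧ ∀ t, 0 ≤ t → ∀ p, comp Y (g t) p = Matrix.diagonal (d t) := by
  obtain ⟨q⟩ := ‹Nonempty M›
  have hc : ∀ t, 0 ≤ t → ∀ p, comp Y (g t) p = Matrix.diagonal fun i => comp Y (g t) q i i := by
    intro t ht p
    ext i j
    rw [h.homogeneous t ht p q]
    by_cases hij : i = j
    · subst hij; simp
    · rw [Matrix.diagonal_apply_ne _ hij, (h.diagonal t ht q i j hij).1]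
  have hpos : ∀ t, 0 ≤ t → ∀ i, 0 < comp Y (g t) q i i := fun t ht i =>
    (h.metric t ht q).2 _ ((hY.linearIndependent q).ne_zero i)
  refine ⟨fun t i => comp Y (g t) q i i, ⟨hpos, ?_, fun t ht i => ?_⟩, hc⟩
  · funext i
    simp [h.initial q]
  · have := h.ricciFlow t ht q i i
    rwa [hY.ricci_eq (fun i => (hpos t ht i).ne') (hc t ht), Matrix.diagonal_apply_eq] at this

theorem IsDiagSol.isDiagonalFlow {Y : Fin 4 → VField M} (hY : IsU3I0Frame Y)
    {l : Fin 4 → ℝ} {d : ℝ → Fin 4 → ℝ} (h : IsDiagSol l d) {g : ℝ → TwoTensor M}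
    (hg : ∀ t p, comp Y (g t) p = Matrix.diagonal (d t)) :
    IsDiagonalFlow Y l g where
  metric t ht := isMetric_of_comp_eq_diagonal hY.linearIndependent (h.pos t ht) (hg t)
  homogeneous t _ p q := by rw [hg, hg]
  diagonal t ht p i j hij := by
    rw [hY.ricci_eq (fun i => (h.pos t ht i).ne') (hg t), hg, Matrix.diagonal_apply_ne _ hij,
      Matrix.diagonal_apply_ne _ hij]
    exact ⟨rfl, rfl⟩
  ricciFlow t ht p i j := by
    rw [hY.ricci_eq (fun i => (h.pos t ht i).ne') (hg t)]
    simp only [hg]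
    by_cases hij : i = j
    · subst hij
      simpa using h.deriv t ht i
    · simpa [Matrix.diagonal_apply_ne _ hij] using
        hasDerivWithinAt_const (x := t) (s := Set.Ici 0) (c := (0 : ℝ))
  initial p := by rw [hg, h.initial]

end

/-! ### The explicit solution -/

/-- The increasing function `x ↦ x - k arctan (x / k)`; with `k = S`, its value at the first metric
component is affine in time. It is the identity for `k = 0`, also with the convention
`x / 0 = 0`. -/
def clock (k x : ℝ) : ℝ := x - k * Real.arctan (x / k)

theorem hasDerivAt_clock (k : ℝ) {x : ℝ} (hx : x ≠ 0) :
    HasDerivAt (clock k) (x ^ 2 / (x ^ 2 + k ^ 2)) x := by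
  have h := (hasDerivAt_id x).sub ((((hasDerivAt_id x).div_const k).arctan).const_mul k)
  refine h.congr_deriv ?_
  by_cases hk : k = 0
  · simp [hk, hx]
  · have : x ^ 2 + k ^ 2 ≠ 0 := by positivity
    have : k ^ 2 + x ^ 2 ≠ 0 := by positivity
    simp only [id]
    field_simp
    ring

theorem continuous_clock (k : ℝ) : Continuous (clock k) := by
  unfold clock
  fun_prop

theorem clock_strictMono (k : ℝ) : StrictMono (clock k) := by
  have aux : ∀ D : Set ℝ, Convex ℝ D → (0 : ℝ) ∉ interior D → StrictMonoOn (clock k) D :=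
    fun D hD h0 => strictMonoOn_of_deriv_pos hD (continuous_clock k).continuousOn fun x hx => by
      have hx0 : x ≠ 0 := fun h => h0 (h ▸ hx)
      rw [(hasDerivAt_clock k hx0).deriv]
      positivity
  exact (aux (Set.Iic 0) (convex_Iic 0) (by simp)).Iic_union_Ici
    (aux (Set.Ici 0) (convex_Ici 0) (by simp))

/-- `clock` is at bounded distance from the identity, so it is onto and does not affect the leading
term of its inverse. -/
theorem abs_clock_sub_le (k x : ℝ) : |clock k x - x| ≤ |k| * (Real.pi / 2) := by
  rw [clock, sub_sub_cancel_left, abs_neg, abs_mul]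
  exact mul_le_mul_of_nonneg_left (abs_le.2 ⟨(Real.neg_pi_div_two_lt_arctan _).le,
    (Real.arctan_lt_pi_div_two _).le⟩) (abs_nonneg k)

theorem clock_surjective (k : ℝ) : Function.Surjective (clock k) := by
  refine (continuous_clock k).surjective ?_ ?_
  · refine Filter.tendsto_atTop_mono (f := fun x => x - |k| * (Real.pi / 2)) (fun x => ?_)
      (Filter.tendsto_atTop_add_const_right _ _ Filter.tendsto_id)
    linarith [neg_le_of_abs_le (abs_clock_sub_le k x)]
  · refine Filter.tendsto_atBot_mono (g := clock k) (f := fun x => x + |k| * (Real.pi / 2))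
      (fun x => ?_) (Filter.tendsto_atBot_add_const_right _ _ Filter.tendsto_id)
    linarith [le_of_abs_le (abs_clock_sub_le k x)]

/-- The function `clock k` as an order isomorphism of the real line. -/
def clockIso (k : ℝ) : ℝ ≃o ℝ :=
  (clock_strictMono k).orderIsoOfSurjective _ (clock_surjective k)

theorem clock_clockIso_symm (k y : ℝ) : clock k ((clockIso k).symm y) = y :=
  (clockIso k).apply_symm_apply y

theorem clockIso_symm_clock (k x : ℝ) : (clockIso k).symm (clock k x) = x :=
  (clockIso k).symm_apply_apply x

theorem clock_zero (k : ℝ) : clock k 0 = 0 := by simp [clock]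

theorem clockIso_symm_pos {k y : ℝ} (hy : 0 < y) : 0 < (clockIso k).symm y := by
  rw [← (clock_strictMono k).lt_iff_lt, clock_zero, clock_clockIso_symm]
  exact hy

theorem clock_pos {k x : ℝ} (hx : 0 < x) : 0 < clock k x :=
  clock_zero k ▸ clock_strictMono k hx

/-- The derivative of `clock` vanishes at the origin if `k ≠ 0`, hence the restriction to positive
values. -/
theorem hasDerivAt_clockIso_symm {k y : ℝ} (hy : 0 < y) :
    HasDerivAt (clockIso k).symm (1 + (k / (clockIso k).symm y) ^ 2) y := by
  have hx := clockIso_symm_pos (k := k) hy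
  have h := HasDerivAt.of_local_left_inverse ((clockIso k).symm.continuous.continuousAt (x := y))
    (hasDerivAt_clock k hx.ne') (by positivity)
    (Filter.Eventually.of_forall fun z => clock_clockIso_symm k z)
  refine h.congr_deriv ?_
  field_simp

/-- The quantity `K = λ₂ λ₃ λ₄²`, which is conserved by the flow. -/
def invK (l : Fin 4 → ℝ) : ℝ := l 1 * l 2 * l 3 ^ 2

/-- The conserved quantity `S = λ₁ (λ₂ - λ₃) / (2 √(λ₂ λ₃))`. -/
def invS (l : Fin 4 → ℝ) : ℝ := l 0 * (l 1 - l 2) / (2 * √(l 1 * l 2))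

/-- The first component of the solution with initial data `l`, obtained by inverting
`clock`. -/
def solA (l : Fin 4 → ℝ) (t : ℝ) : ℝ := (clockIso (invS l)).symm (4 * t + clock (invS l) (l 0))

/-- The last component of the solution with initial data `l`. -/
def solD (l : Fin 4 → ℝ) (t : ℝ) : ℝ := ((l 3 ^ 3)⁻¹ + 3 * t / invK l) ^ (-(1 / 3) : ℝ)

/-- The solution with initial data `l`. The second and third components have the product `K / λ₄²`
and the ratio `exp (2 w)`, where `sinh w = S / λ₁`. -/
def sol (l : Fin 4 → ℝ) (t : ℝ) : Fin 4 → ℝ :=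
  ![solA l t,
    √(invK l) / solD l t * Real.exp (Real.arsinh (invS l / solA l t)),
    √(invK l) / solD l t * Real.exp (-Real.arsinh (invS l / solA l t)),
    solD l t]

section
variable {l : Fin 4 → ℝ} (hl : ∀ i, 0 < l i)
include hl

theorem invK_pos : 0 < invK l := by
  have h1 := hl 1
  have h2 := hl 2
  have h3 := hl 3
  unfold invK
  positivity

theorem solA_pos {t : ℝ} (ht : 0 ≤ t) : 0 < solA l t :=
  clockIso_symm_pos (by linarith [clock_pos (k := invS l) (hl 0)])

theorem solD_base_pos {t : ℝ} (ht : 0 ≤ t) : 0 < (l 3 ^ 3)⁻¹ + 3 * t / invK l := by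
  have h3 := hl 3
  have hK := invK_pos hl
  positivity

theorem solD_pos {t : ℝ} (ht : 0 ≤ t) : 0 < solD l t :=
  Real.rpow_pos_of_pos (solD_base_pos hl ht) _

theorem hasDerivAt_solA {t : ℝ} (ht : 0 ≤ t) :
    HasDerivAt (solA l) (4 * (1 + (invS l / solA l t) ^ 2)) t := by
  have h1 : HasDerivAt (fun t => 4 * t + clock (invS l) (l 0)) 4 t := by
    simpa using ((hasDerivAt_id t).const_mul 4).add_const (clock (invS l) (l 0))
  have h2 := hasDerivAt_clockIso_symm (k := invS l)
    (y := 4 * t + clock (invS l) (l 0)) (by linarith [clock_pos (k := invS l) (hl 0)])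
  refine (h2.comp t h1).congr_deriv ?_
  rw [solA]
  ring

theorem hasDerivAt_solD {t : ℝ} (ht : 0 ≤ t) :
    HasDerivAt (solD l) (-solD l t ^ 4 / invK l) t := by
  have hb := solD_base_pos hl ht
  have h1 : HasDerivAt (fun t => (l 3 ^ 3)⁻¹ + 3 * t / invK l) (3 / invK l) t := by
    simpa using (((hasDerivAt_id t).const_mul 3).div_const (invK l)).const_add ((l 3 ^ 3)⁻¹)
  have h2 := h1.rpow_const (p := (-(1 / 3) : ℝ)) (Or.inl hb.ne')
  refine h2.congr_deriv ?_
  rw [solD, ← Real.rpow_mul_natCast hb.le]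
  norm_num
  ring

theorem isDiagSol_sol : IsDiagSol l (sol l) where
  pos t ht i := by
    have hA := solA_pos hl ht
    have hD := solD_pos hl ht
    have hK := invK_pos hl
    fin_cases i <;> simp [sol] <;> positivity
  initial := by
    have h0 := hl 0
    have h1 := hl 1
    have h2 := hl 2
    have h3 := hl 3
    have hA : solA l 0 = l 0 := by simp [solA, clockIso_symm_clock]
    have hD : solD l 0 = l 3 := by
      rw [solD, mul_zero, zero_div, add_zero, ← inv_pow, ← Real.rpow_natCast,
        ← Real.rpow_mul (by positivity)]
      norm_num
      rw [Real.rpow_neg_one, inv_inv]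
    have hK : √(invK l) = √(l 1) * √(l 2) * l 3 := by
      rw [invK, Real.sqrt_mul (by positivity), Real.sqrt_sq h3.le, Real.sqrt_mul h1.le]
    -- the value of `w` at time zero is `log √(λ₂ / λ₃)`
    have hw : Real.arsinh (invS l / l 0) = Real.log (√(l 1) / √(l 2)) := by
      rw [← Real.arsinh_sinh (Real.log _), Real.sinh_log (by positivity)]
      congr 1
      rw [invS, Real.sqrt_mul h1.le]
      have e1 := Real.sq_sqrt h1.le
      have e2 := Real.sq_sqrt h2.le
      have p1 := Real.sqrt_pos.2 h1
      have p2 := Real.sqrt_pos.2 h2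
      field_simp
      rw [e1, e2]
    have p1 := Real.sqrt_pos.2 h1
    have p2 := Real.sqrt_pos.2 h2
    funext i
    fin_cases i
    · simp [sol, hA]
    · simp only [sol, hA, hD, hw, hK, Real.exp_log (div_pos p1 p2)]
      simp
      field_simp
      exact Real.sq_sqrt h1.le
    · simp only [sol, hA, hD, hw, hK, Real.exp_neg, Real.exp_log (div_pos p1 p2)]
      simp
      field_simp
      exact Real.sq_sqrt h2.le
    · simp [sol, hD]
  deriv t ht i := by
    have hA := solA_pos hl ht
    have hD := solD_pos hl ht
    have hK := invK_pos hl
    have dA := hasDerivAt_solA hl ht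
    have dD := hasDerivAt_solD hl ht
    have hKs : √(invK l) ^ 2 = invK l := Real.sq_sqrt hK.le
    have hKp : 0 < √(invK l) := Real.sqrt_pos.2 hK
    have dw : HasDerivAt (fun t => Real.arsinh (invS l / solA l t))
        (-(4 * (invS l / solA l t) * √(1 + (invS l / solA l t) ^ 2) / solA l t)) t := by
      have h := ((hasDerivAt_const t (invS l)).div dA hA.ne').arsinh
      refine h.congr_deriv ?_
      have hs : √(1 + (invS l / solA l t) ^ 2) ^ 2 = 1 + (invS l / solA l t) ^ 2 :=
        Real.sq_sqrt (by positivity)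
      have hsp : 0 < √(1 + (invS l / solA l t) ^ 2) := Real.sqrt_pos.2 (by positivity)
      rw [zero_mul, ← hs, smul_eq_mul, Real.sqrt_sq hsp.le]
      generalize √(1 + (invS l / solA l t) ^ 2) = r at *
      field_simp
      ring
    have hcosh := Real.cosh_arsinh (invS l / solA l t)
    have hsinh := Real.sinh_arsinh (invS l / solA l t)
    rw [Real.cosh_eq, Real.exp_neg] at hcosh
    rw [Real.sinh_eq, Real.exp_neg] at hsinh
    have hex := Real.exp_pos (Real.arsinh (invS l / solA l t))
    have dB := (((hasDerivAt_const t √(invK l)).div dD hD.ne').mul dw.exp).hasDerivWithinAt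
      (s := Set.Ici 0)
    have dC := (((hasDerivAt_const t √(invK l)).div dD hD.ne').mul dw.neg.exp).hasDerivWithinAt
      (s := Set.Ici 0)
    have dA' := dA.hasDerivWithinAt (s := Set.Ici 0)
    have dD' := dD.hasDerivWithinAt (s := Set.Ici 0)
    -- all terms are rational functions of `λ₁`, `λ₄`, `√(invK l)` and `exp w`
    fin_cases i <;> [refine dA'.congr_deriv ?_; refine dB.congr_deriv ?_;
      refine dC.congr_deriv ?_; refine dD'.congr_deriv ?_] <;>
      clear dA dD dA' dD' dB dC dw <;>
      simp only [sol, ricciDiag, Real.exp_neg, ← hcosh, Pi.div_apply, Pi.neg_apply] <;>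
      generalize Real.exp (Real.arsinh (invS l / solA l t)) = x at * <;>
      try rw [← hsinh]
    all_goals
      generalize √(invK l) = R at *
      try rw [← hKs]
      simp
      field_simp
      try ring

end

/-! ### Conserved quantities and uniqueness -/

theorem eq_of_hasDerivWithinAt_zero {f : ℝ → ℝ}
    (hf : ∀ t, 0 ≤ t → HasDerivWithinAt f 0 (Set.Ici 0) t) {t : ℝ} (ht : 0 ≤ t) : f t = f 0 := by
  refine (convex_Ici (0 : ℝ)).is_const_of_fderivWithin_eq_zero (𝕜 := ℝ)
    (fun s hs => (hf s hs).differentiableWithinAt) (fun s hs => ?_) ht Set.self_mem_Ici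
  rw [(hf s hs).hasFDerivWithinAt.fderivWithin (uniqueDiffOn_Ici 0 s hs)]
  ext
  simp

namespace IsDiagSol
variable {l : Fin 4 → ℝ} {d : ℝ → Fin 4 → ℝ}

theorem invK_eq (h : IsDiagSol l d) {t : ℝ} (ht : 0 ≤ t) : invK (d t) = invK l := by
  rw [← h.initial]
  refine eq_of_hasDerivWithinAt_zero (f := fun t => invK (d t)) (fun s hs => ?_) ht
  have p0 := h.pos s hs 0
  have p1 := h.pos s hs 1
  have p2 := h.pos s hs 2
  have p3 := h.pos s hs 3
  refine (((h.deriv s hs 1).mul (h.deriv s hs 2)).mul ((h.deriv s hs 3).pow 2)).congr_deriv ?_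
  simp [ricciDiag]
  field_simp
  ring

theorem invS_eq (h : IsDiagSol l d) {t : ℝ} (ht : 0 ≤ t) : invS (d t) = invS l := by
  rw [← h.initial]
  refine eq_of_hasDerivWithinAt_zero (f := fun t => invS (d t)) (fun s hs => ?_) ht
  have p0 := h.pos s hs 0
  have p1 := h.pos s hs 1
  have p2 := h.pos s hs 2
  have p3 := h.pos s hs 3
  have hR := Real.sqrt_pos.2 (mul_pos p1 p2)
  refine (((h.deriv s hs 0).mul ((h.deriv s hs 1).sub (h.deriv s hs 2))).div
    ((((h.deriv s hs 1).mul (h.deriv s hs 2)).sqrt (mul_pos p1 p2).ne').const_mul 2)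
    (by simpa using (mul_pos two_pos hR).ne')).congr_deriv ?_
  have hR2 : d s 1 = √(d s 1 * d s 2) ^ 2 / d s 2 := by
    rw [Real.sq_sqrt (mul_pos p1 p2).le]
    field_simp
  simp [ricciDiag, -div_eq_zero_iff]
  generalize √(d s 1 * d s 2) = R at *
  rw [hR2]
  field_simp
  ring

theorem inv_pow_last_eq (h : IsDiagSol l d) {t : ℝ} (ht : 0 ≤ t) :
    (d t 3 ^ 3)⁻¹ = (l 3 ^ 3)⁻¹ + 3 * t / invK l := by
  have key : (d t 3 ^ 3)⁻¹ - 3 * t / invK l = (d 0 3 ^ 3)⁻¹ - 3 * 0 / invK l := by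
    refine eq_of_hasDerivWithinAt_zero (f := fun t => (d t 3 ^ 3)⁻¹ - 3 * t / invK l)
      (fun s hs => ?_) ht
    have p1 := h.pos s hs 1
    have p2 := h.pos s hs 2
    have p3 := h.pos s hs 3
    refine ((((h.deriv s hs 3).pow 3).inv (by simpa using p3.ne')).sub
      (((hasDerivWithinAt_id s _).const_mul 3).div_const (invK l))).congr_deriv ?_
    rw [← h.invK_eq hs]
    simp [ricciDiag, invK]
    field_simp
    ring
  rw [h.initial, mul_zero, zero_div] at key
  linarith

/-- The derivative of `clock` is `λ₁² / (λ₁² + S²) = 4 λ₂ λ₃ / (λ₂ + λ₃)²`, which is `4` divided by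
the derivative of `λ₁`. -/
theorem clock_eq (h : IsDiagSol l d) {t : ℝ} (ht : 0 ≤ t) :
    clock (invS l) (d t 0) = 4 * t + clock (invS l) (l 0) := by
  have key : clock (invS l) (d t 0) - 4 * t = clock (invS l) (d 0 0) - 4 * 0 := by
    refine eq_of_hasDerivWithinAt_zero (f := fun t => clock (invS l) (d t 0) - 4 * t)
      (fun s hs => ?_) ht
    have p0 := h.pos s hs 0
    have p1 := h.pos s hs 1
    have p2 := h.pos s hs 2
    have hR := Real.sqrt_pos.2 (mul_pos p1 p2)
    refine (((hasDerivAt_clock (invS l) p0.ne').comp_hasDerivWithinAt s (h.deriv s hs 0)).sub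
      ((hasDerivWithinAt_id s _).const_mul 4)).congr_deriv ?_
    have hR2 : √(d s 1 * d s 2) ^ 2 = d s 1 * d s 2 := Real.sq_sqrt (mul_pos p1 p2).le
    have hS : invS (d s) ^ 2 = d s 0 ^ 2 * (d s 1 - d s 2) ^ 2 / (4 * (d s 1 * d s 2)) := by
      rw [invS, div_pow, mul_pow, mul_pow, hR2]
      norm_num
    rw [← h.invS_eq hs, hS]
    have hsum : d s 0 ^ 2 + d s 0 ^ 2 * (d s 1 - d s 2) ^ 2 / (4 * (d s 1 * d s 2)) =
        d s 0 ^ 2 * (d s 1 + d s 2) ^ 2 / (4 * (d s 1 * d s 2)) := by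
      field_simp
      ring
    rw [hsum]
    simp [ricciDiag]
    field_simp
    ring
  rw [h.initial] at key
  linarith

/-- The conserved quantities determine the solution. -/
theorem unique {e : ℝ → Fin 4 → ℝ} (h : IsDiagSol l d) (h' : IsDiagSol l e) {t : ℝ}
    (ht : 0 ≤ t) : d t = e t := by
  have p1 := h.pos t ht 1
  have p2 := h.pos t ht 2
  have p3 := h.pos t ht 3
  have q0 := h'.pos t ht 0
  have q1 := h'.pos t ht 1
  have q2 := h'.pos t ht 2
  have q3 := h'.pos t ht 3
  have e0 : d t 0 = e t 0 :=
    (clock_strictMono (invS l)).injective ((h.clock_eq ht).trans (h'.clock_eq ht).symm)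
  have e3 : d t 3 = e t 3 := by
    have := (h.inv_pow_last_eq ht).trans (h'.inv_pow_last_eq ht).symm
    exact (pow_left_inj₀ p3.le q3.le three_ne_zero).1 (inv_injective this)
  have eP : d t 1 * d t 2 = e t 1 * e t 2 := by
    have := (h.invK_eq ht).trans (h'.invK_eq ht).symm
    rw [invK, invK, e3] at this
    exact mul_right_cancel₀ (pow_pos q3 2).ne' this
  have eS : d t 1 - d t 2 = e t 1 - e t 2 := by
    have := (h.invS_eq ht).trans (h'.invS_eq ht).symm
    rw [invS, invS, e0, eP] at this
    have hR := Real.sqrt_pos.2 (mul_pos q1 q2)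
    exact mul_left_cancel₀ q0.ne' ((div_left_inj' (by positivity)).1 this)
  have eT : d t 1 + d t 2 = e t 1 + e t 2 := by
    refine (pow_left_inj₀ (by positivity) (by positivity) two_ne_zero).1 ?_
    linear_combination 4 * eP + (d t 1 - d t 2 + (e t 1 - e t 2)) * eS
  funext i
  fin_cases i
  · exact e0
  · change d t 1 = e t 1
    linarith
  · change d t 2 = e t 2
    linarith
  · exact e3

end IsDiagSol

/-! ### Asymptotics -/

open Filter Topology

/-- The square roots, at the time `t = σ ^ 6`, of the growth rates `t, t^(1/3), t^(1/3),
t^(-1/3)` of the components of a solution. -/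
def weight (σ : ℝ) : Fin 4 → ℝ := ![σ ^ 3, σ, σ, σ⁻¹]

/-- The leading coefficient of the last component of a solution with invariant `K`. -/
def leadD (K : ℝ) : ℝ := (3 / K) ^ (-(1 / 3) : ℝ)

/-- The leading coefficients of a solution with invariant `K`. -/
def lead (K : ℝ) : Fin 4 → ℝ := ![4, √K / leadD K, √K / leadD K, leadD K]

theorem leadD_pos {K : ℝ} (hK : 0 < K) : 0 < leadD K := Real.rpow_pos_of_pos (by positivity) _

theorem lead_pos {K : ℝ} (hK : 0 < K) (i : Fin 4) : 0 < lead K i := by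
  have h := leadD_pos hK
  fin_cases i <;> simp [lead] <;> positivity

theorem leadD_inj {K K' : ℝ} (hK : 0 < K) (hK' : 0 < K') (h : leadD K = leadD K') : K = K' := by
  have h1 : 3 / K = 3 / K' :=
    Real.rpow_left_injOn (x := (-(1 / 3) : ℝ)) (by norm_num)
      (show (0 : ℝ) ≤ 3 / K by positivity) (show (0 : ℝ) ≤ 3 / K' by positivity) h
  field_simp at h1
  exact h1.symm

theorem weight_pos {σ : ℝ} (hσ : 0 < σ) (i : Fin 4) : 0 < weight σ i := by
  fin_cases i <;> simp [weight] <;> positivity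

theorem tendsto_solA (l : Fin 4 → ℝ) : Tendsto (fun t => solA l t / t) atTop (𝓝 4) := by
  have hb : ∀ t, |solA l t - 4 * t| ≤ |invS l| * (Real.pi / 2) + |clock (invS l) (l 0)| := by
    intro t
    have h1 := abs_clock_sub_le (invS l) (solA l t)
    rw [solA, clock_clockIso_symm, ← solA, abs_sub_comm] at h1
    calc |solA l t - 4 * t|
        = |solA l t - (4 * t + clock (invS l) (l 0)) + clock (invS l) (l 0)| := by ring_nf
      _ ≤ _ := (abs_add_le _ _).trans (by linarith)
  have h0 : Tendsto (fun t => (solA l t - 4 * t) / t) atTop (𝓝 0) := by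
    refine squeeze_zero_norm' (a := fun t =>
      (|invS l| * (Real.pi / 2) + |clock (invS l) (l 0)|) / t) ?_
      (tendsto_const_nhds.div_atTop tendsto_id)
    filter_upwards [eventually_gt_atTop 0] with t ht
    rw [Real.norm_eq_abs, abs_div, abs_of_pos ht]
    exact div_le_div_of_nonneg_right (hb t) ht.le
  have h1 := h0.add_const 4
  rw [zero_add] at h1
  refine h1.congr' ?_
  filter_upwards [eventually_gt_atTop 0] with t ht
  field_simp
  ring

section
variable {l : Fin 4 → ℝ} (hl : ∀ i, 0 < l i)
include hl

theorem tendsto_solD : Tendsto (fun σ => solD l (σ ^ 6) / (σ⁻¹) ^ 2) atTop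
    (𝓝 (leadD (invK l))) := by
  have hK := invK_pos hl
  have h6 : Tendsto (fun σ : ℝ => σ ^ 6) atTop atTop := tendsto_pow_atTop (by norm_num)
  have h1 : Tendsto (fun σ : ℝ => (l 3 ^ 3)⁻¹ / σ ^ 6 + 3 / invK l) atTop (𝓝 (0 + 3 / invK l)) :=
    (tendsto_const_nhds.div_atTop h6).add_const _
  rw [zero_add] at h1
  have h2 := h1.rpow_const (p := (-(1 / 3) : ℝ)) (Or.inl (by positivity))
  refine h2.congr' ?_
  filter_upwards [eventually_gt_atTop 0] with σ hσ
  have hb := solD_base_pos hl (pow_pos hσ 6).le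
  have e : (l 3 ^ 3)⁻¹ / σ ^ 6 + 3 / invK l =
      ((l 3 ^ 3)⁻¹ + 3 * σ ^ 6 / invK l) * (σ⁻¹ ^ 2) ^ 3 := by
    field_simp
  have hs : ((σ⁻¹ ^ 2) ^ 3) ^ (-(1 / 3) : ℝ) = (σ⁻¹ ^ 2)⁻¹ := by
    rw [← Real.rpow_natCast_mul (by positivity)]
    norm_num
    rw [Real.rpow_neg_one, inv_inv]
  rw [e, Real.mul_rpow hb.le (by positivity), hs, solD, ← div_eq_mul_inv]

theorem tendsto_sol (i : Fin 4) :
    Tendsto (fun σ => sol l (σ ^ 6) i / weight σ i ^ 2) atTop (𝓝 (lead (invK l) i)) := by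
  have h6 : Tendsto (fun σ : ℝ => σ ^ 6) atTop atTop := tendsto_pow_atTop (by norm_num)
  have hA := (tendsto_solA l).comp h6
  have hD := tendsto_solD hl
  have hw : Tendsto (fun σ => Real.arsinh (invS l / solA l (σ ^ 6))) atTop (𝓝 0) := by
    have hA' : Tendsto (fun σ => solA l (σ ^ 6)) atTop atTop := by
      refine (hA.pos_mul_atTop (by norm_num) h6).congr' ?_
      filter_upwards [eventually_gt_atTop 0] with σ hσ
      simp only [Function.comp]
      field_simp
    simpa using (tendsto_const_nhds.div_atTop hA').arsinh
  have hx : ∀ {f : ℝ → ℝ}, Tendsto f atTop (𝓝 0) →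
      Tendsto (fun σ => √(invK l) / solD l (σ ^ 6) * Real.exp (f σ) / σ ^ 2) atTop
        (𝓝 (√(invK l) / leadD (invK l))) := by
    intro f hf
    have h := (tendsto_const_nhds (x := √(invK l))).div hD (leadD_pos (invK_pos hl)).ne'
    have h2 := h.mul ((Real.continuous_exp.tendsto 0).comp hf)
    rw [Real.exp_zero, mul_one] at h2
    refine h2.congr' ?_
    filter_upwards [eventually_gt_atTop 0] with σ hσ
    have := solD_pos hl (pow_pos hσ 6).le
    simp only [Function.comp, Pi.div_apply]
    field_simp
  fin_cases i
  · refine hA.congr fun σ => ?_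
    simp [sol, weight, ← pow_mul]
  · exact hx hw
  · exact hx (by simpa using hw.neg)
  · exact hD

end

/-- Rescaled by the weights, which decrease fast enough, the unipotent transition matrices become
asymptotically trivial. -/
theorem tendsto_transition_weight (a₁ a₃ a₆ : ℝ) (i k : Fin 4) :
    Tendsto (fun σ => transition a₁ a₃ a₆ i k * weight σ k / weight σ i) atTop
      (𝓝 ((1 : Matrix (Fin 4) (Fin 4) ℝ) i k)) := by
  have hself : ∀ j, Tendsto (fun σ => weight σ j / weight σ j) atTop (𝓝 1) := fun j =>
    tendsto_const_nhds.congr' (by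
      filter_upwards [eventually_gt_atTop 0] with σ hσ
      exact (div_self (weight_pos hσ j).ne').symm)
  have hz : ∀ (c : ℝ) (n : ℕ), n ≠ 0 → Tendsto (fun σ : ℝ => c / σ ^ n) atTop (𝓝 0) :=
    fun c n hn => tendsto_const_nhds.div_atTop (tendsto_pow_atTop hn)
  have off : ∀ (j m : Fin 4) (c : ℝ) (n : ℕ), n ≠ 0 →
      (∀ σ, 0 < σ → weight σ m / weight σ j = 1 / σ ^ n) →
      Tendsto (fun σ => c * weight σ m / weight σ j) atTop (𝓝 0) := fun j m c n hn hw =>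
    (hz c n hn).congr' (by
      filter_upwards [eventually_gt_atTop 0] with σ hσ
      rw [mul_div_assoc, hw σ hσ, mul_one_div])
  have w01 : ∀ σ : ℝ, 0 < σ → weight σ 1 / weight σ 0 = 1 / σ ^ 2 := fun σ hσ => by
    simp [weight]; field_simp
  have w02 : ∀ σ : ℝ, 0 < σ → weight σ 2 / weight σ 0 = 1 / σ ^ 2 := fun σ hσ => by
    simp [weight]; field_simp
  have w03 : ∀ σ : ℝ, 0 < σ → weight σ 3 / weight σ 0 = 1 / σ ^ 4 := fun σ hσ => by
    simp [weight]; field_simp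
  have w13 : ∀ σ : ℝ, 0 < σ → weight σ 3 / weight σ 1 = 1 / σ ^ 2 := fun σ hσ => by
    simp [weight]; field_simp
  have w23 : ∀ σ : ℝ, 0 < σ → weight σ 3 / weight σ 2 = 1 / σ ^ 2 := fun σ hσ => by
    simp [weight]; field_simp
  have h01 := off 0 1 (-a₃) 2 two_ne_zero w01
  have h02 := off 0 2 a₁ 2 two_ne_zero w02
  have h03 := off 0 3 a₆ 4 four_ne_zero w03
  have h13 := off 1 3 a₃ 2 two_ne_zero w13
  have h23 := off 2 3 a₁ 2 two_ne_zero w23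
  fin_cases i <;> fin_cases k <;> simp [transition] <;>
    first | exact hself _ | exact h02 | exact h03 | exact h13 | exact h23 | simpa using h01

/-- The squared norm, with respect to the metric `diagonal d`, of the difference between
`diagonal e`, taken in a frame with transition matrix `N`, and `diagonal d`. -/
def defect (N : Matrix (Fin 4) (Fin 4) ℝ) (e d : Fin 4 → ℝ) : ℝ :=
  ∑ i, ∑ j, ((N * Matrix.diagonal e * N.transpose) i j - Matrix.diagonal d i j) ^ 2 / (d i * d j)

theorem tendsto_defect {m l : Fin 4 → ℝ} (hm : ∀ i, 0 < m i) (hl : ∀ i, 0 < l i)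
    (c₁ c₃ c₆ : ℝ) :
    Tendsto (fun t => defect (transition c₁ c₃ c₆) (sol m t) (sol l t)) atTop
      (𝓝 (∑ i, (lead (invK m) i - lead (invK l) i) ^ 2 / lead (invK l) i ^ 2)) := by
  have hσ : Tendsto (fun t : ℝ => t ^ (1 / 6 : ℝ)) atTop atTop := tendsto_rpow_atTop (by norm_num)
  suffices h : Tendsto (fun σ : ℝ => defect (transition c₁ c₃ c₆) (sol m (σ ^ 6)) (sol l (σ ^ 6)))
      atTop (𝓝 (∑ i, (lead (invK m) i - lead (invK l) i) ^ 2 / lead (invK l) i ^ 2)) by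
    refine (h.comp hσ).congr' ?_
    filter_upwards [eventually_ge_atTop 0] with t ht
    have : (t ^ (1 / 6 : ℝ)) ^ 6 = t := by
      rw [← Real.rpow_mul_natCast ht]
      norm_num
    simp only [Function.comp, this]
  have hN := tendsto_transition_weight c₁ c₃ c₆
  set N := transition c₁ c₃ c₆ with hNdef
  have he := fun i => tendsto_sol hm i
  have hd := fun i => tendsto_sol hl i
  have hL := lead_pos (invK_pos hl)
  -- the entries of the difference, rescaled by the weights
  have hT : ∀ i j, Tendsto (fun σ : ℝ =>
      ((N * Matrix.diagonal (sol m (σ ^ 6)) * N.transpose) i j -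
        Matrix.diagonal (sol l (σ ^ 6)) i j) / (weight σ i * weight σ j)) atTop
      (𝓝 (Matrix.diagonal (fun i => lead (invK m) i - lead (invK l) i) i j)) := by
    intro i j
    have h1 := tendsto_finsetSum Finset.univ fun k _ => ((hN i k).mul (hN j k)).mul (he k)
    have h2 : Tendsto (fun σ : ℝ => Matrix.diagonal (sol l (σ ^ 6)) i j /
        (weight σ i * weight σ j)) atTop (𝓝 (Matrix.diagonal (lead (invK l)) i j)) := by
      by_cases hij : i = j
      · subst hij
        simpa [sq] using hd i
      · simp [Matrix.diagonal_apply_ne _ hij]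
    have h3 := h1.sub h2
    have hlim : ∑ k, (1 : Matrix (Fin 4) (Fin 4) ℝ) i k * (1 : Matrix (Fin 4) (Fin 4) ℝ) j k *
        lead (invK m) k - Matrix.diagonal (lead (invK l)) i j =
        Matrix.diagonal (fun i => lead (invK m) i - lead (invK l) i) i j := by
      by_cases hij : i = j
      · subst hij
        simp [Matrix.one_apply]
      · simp [Matrix.one_apply, hij]
    rw [hlim] at h3
    refine h3.congr' ?_
    filter_upwards [eventually_gt_atTop 0] with σ hσ
    rw [sub_div, Matrix.mul_apply, Finset.sum_div]
    congr 1
    refine Finset.sum_congr rfl fun k _ => ?_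
    have hi := weight_pos hσ i
    have hj := weight_pos hσ j
    have hk := weight_pos hσ k
    rw [Matrix.mul_diagonal, Matrix.transpose_apply]
    field_simp
  have hsum := tendsto_finsetSum Finset.univ fun i _ => tendsto_finsetSum Finset.univ
    fun j _ => ((hT i j).pow 2).div ((hd i).mul (hd j)) (mul_pos (hL i) (hL j)).ne'
  have hlim : ∑ i, ∑ j, Matrix.diagonal (fun i => lead (invK m) i - lead (invK l) i) i j ^ 2 /
      (lead (invK l) i * lead (invK l) j) =
      ∑ i, (lead (invK m) i - lead (invK l) i) ^ 2 / lead (invK l) i ^ 2 := by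
    refine Finset.sum_congr rfl fun i _ => ?_
    rw [Finset.sum_eq_single i]
    · simp [sq]
    · intro j _ hij
      simp [Matrix.diagonal_apply_ne _ hij.symm]
    · simp
  rw [hlim] at hsum
  refine hsum.congr' ?_
  filter_upwards [eventually_gt_atTop 0] with σ hσ
  refine Finset.sum_congr rfl fun i _ => Finset.sum_congr rfl fun j _ => ?_
  have hi := weight_pos hσ i
  have hj := weight_pos hσ j
  have pi := (isDiagSol_sol hl).pos _ (pow_pos hσ 6).le i
  have pj := (isDiagSol_sol hl).pos _ (pow_pos hσ 6).le j
  simp only [Pi.div_apply]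
  field_simp

theorem sum_lead_eq_zero_iff {K K' : ℝ} (hK : 0 < K) (hK' : 0 < K') :
    ∑ i, (lead K i - lead K' i) ^ 2 / lead K' i ^ 2 = 0 ↔ K = K' := by
  constructor
  · intro h
    rw [Finset.sum_eq_zero_iff_of_nonneg fun i _ => by positivity] at h
    have h3 := h 3 (Finset.mem_univ _)
    rw [div_eq_zero_iff, or_iff_left (pow_pos (lead_pos hK' 3) 2).ne', sq_eq_zero_iff,
      sub_eq_zero] at h3
    exact leadD_inj hK hK' h3
  · rintro rfl
    simp

/-! ### Quasi-convergence -/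

/-- The squared norm as a trace, `tr (Tᵀ H⁻¹ T (H⁻¹)ᵀ)`. -/
theorem tensorNorm_eq_sqrt_trace (X : Fin 4 → VField M) (h T : TwoTensor M) (p : M) :
    tensorNorm X h T p = √((comp X T p).transpose * (comp X h p)⁻¹ * comp X T p *
      ((comp X h p)⁻¹).transpose).trace := by
  rw [tensorNorm]
  congr 1
  simp only [Matrix.trace, Matrix.diag, Matrix.mul_apply, Matrix.transpose_apply, Finset.sum_mul]
  rw [Finset.sum_comm]
  refine Finset.sum_congr rfl fun j _ => ?_
  rw [Finset.sum_comm, Finset.sum_congr rfl fun k _ => Finset.sum_comm, Finset.sum_comm]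
  exact Finset.sum_congr rfl fun l _ => Finset.sum_congr rfl fun k _ =>
    Finset.sum_congr rfl fun i _ => by ring

/-- The norm of a 2-tensor does not depend on the frame in which it is computed. -/
theorem tensorNorm_changeFrame {L : Matrix (Fin 4) (Fin 4) ℝ} (hL : IsUnit L.det)
    (X : Fin 4 → VField M) (h T : TwoTensor M) (p : M) :
    tensorNorm (changeFrame L X) h T p = tensorNorm X h T p := by
  rw [tensorNorm_eq_sqrt_trace, tensorNorm_eq_sqrt_trace, comp_changeFrame, comp_changeFrame]
  have h1 : L⁻¹ * L = 1 := Matrix.nonsing_inv_mul _ hL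
  have h2 : L.transpose * (L.transpose)⁻¹ = 1 :=
    Matrix.mul_nonsing_inv _ (by rwa [Matrix.det_transpose])
  have h3 : (L⁻¹).transpose = (L.transpose)⁻¹ := Matrix.transpose_nonsing_inv L
  generalize comp X h p = H
  generalize comp X T p = S
  congr 1
  calc ((L * S * L.transpose).transpose * (L * H * L.transpose)⁻¹ * (L * S * L.transpose) *
        ((L * H * L.transpose)⁻¹).transpose).trace
      = (L * (S.transpose * (L.transpose * (L.transpose)⁻¹) * H⁻¹ * (L⁻¹ * L) * S *
          (L.transpose * (L.transpose)⁻¹) * (H⁻¹).transpose * L⁻¹)).trace := by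
        rw [Matrix.mul_inv_rev, Matrix.mul_inv_rev]
        simp only [Matrix.transpose_mul, Matrix.transpose_transpose, Matrix.mul_assoc, h3]
        rw [← h3, Matrix.transpose_transpose]
    _ = _ := by
        rw [h1, h2, Matrix.trace_mul_comm]
        simp only [Matrix.mul_assoc, Matrix.mul_one, h1]

theorem tensorNorm_of_comp_eq_diagonal {Y : Fin 4 → VField M} {h T : TwoTensor M} {p : M}
    {d : Fin 4 → ℝ} (hd : ∀ i, d i ≠ 0) (hh : comp Y h p = Matrix.diagonal d) :
    tensorNorm Y h T p = √(∑ i, ∑ j, comp Y T p i j ^ 2 / (d i * d j)) := by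
  have hinv := inv_diagonal hd
  rw [tensorNorm, hh, hinv]
  congr 1
  refine Finset.sum_congr rfl fun i _ => Finset.sum_congr rfl fun j _ => ?_
  simp only [Matrix.diagonal_apply, ite_mul, mul_ite, zero_mul, mul_zero, Finset.sum_ite_eq,
    Finset.mem_univ, if_true]
  have := hd i
  have := hd j
  field_simp

variable [IsManifold (𝓡 4) ∞ M]

theorem IsDiagonalFlow.comp_eq [Nonempty M] {Y : Fin 4 → VField M} (hY : IsU3I0Frame Y)
    {l : Fin 4 → ℝ} {g : ℝ → TwoTensor M} (h : IsDiagonalFlow Y l g) :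
    (∀ i, 0 < l i) ∧ ∀ t, 0 ≤ t → ∀ p, comp Y (g t) p = Matrix.diagonal (sol l t) := by
  obtain ⟨d, hd, hg⟩ := h.exists_isDiagSol hY
  have hl : ∀ i, 0 < l i := hd.initial ▸ hd.pos 0 le_rfl
  refine ⟨hl, fun t ht p => ?_⟩
  rw [hg t ht, hd.unique (isDiagSol_sol hl) ht]

theorem exists_isDiagonalFlow {Y : Fin 4 → VField M} (hY : IsU3I0Frame Y) {l : Fin 4 → ℝ}
    (hl : ∀ i, 0 < l i) : ∃ g : ℝ → TwoTensor M, IsDiagonalFlow Y l g :=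
  ⟨fun t => ofComp hY.linearIndependent (Matrix.diagonal (sol l t)),
    (isDiagSol_sol hl).isDiagonalFlow hY fun _ p => comp_ofComp hY.linearIndependent _ p⟩

theorem IsDiagonalFlow.unique [Nonempty M] {Y : Fin 4 → VField M} (hY : IsU3I0Frame Y)
    {l : Fin 4 → ℝ} {g h : ℝ → TwoTensor M} (hg : IsDiagonalFlow Y l g)
    (hh : IsDiagonalFlow Y l h) {t : ℝ} (ht : 0 ≤ t) : h t = g t :=
  eq_of_comp_eq hY.linearIndependent fun p => by
    rw [(hh.comp_eq hY).2 t ht, (hg.comp_eq hY).2 t ht]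

/-- The transition matrices form a group. -/
theorem exists_transition_mul_eq (a₁ a₃ a₆ b₁ b₃ b₆ : ℝ) :
    ∃ c₁ c₃ c₆, transition c₁ c₃ c₆ * transition b₁ b₃ b₆ = transition a₁ a₃ a₆ := by
  refine ⟨a₁ - b₁, a₃ - b₃, a₆ - b₆ + (a₃ - b₃) * b₃ - (a₁ - b₁) * b₁, ?_⟩
  rw [transition_mul]
  congr 1 <;> ring

/-- The distance between two flows is constant in space, and it tends to a limit as `t → ∞` that
vanishes if and only if the leading coefficients agree. -/
theorem quasiConverges_iff [Nonempty M] {X : Fin 4 → VField M} (hX : IsU3I0Frame X)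
    {a₁ a₃ a₆ b₁ b₃ b₆ : ℝ} {l m : Fin 4 → ℝ} {g h : ℝ → TwoTensor M}
    (hg : IsDiagonalFlow (changeFrame (transition a₁ a₃ a₆) X) l g)
    (hh : IsDiagonalFlow (changeFrame (transition b₁ b₃ b₆) X) m h) :
    QuasiConverges X h g ↔ invK m = invK l := by
  obtain ⟨hl, hg⟩ := hg.comp_eq (hX.changeFrame_transition _ _ _)
  obtain ⟨hm, hh⟩ := hh.comp_eq (hX.changeFrame_transition _ _ _)
  obtain ⟨c₁, c₃, c₆, hc⟩ := exists_transition_mul_eq a₁ a₃ a₆ b₁ b₃ b₆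
  have hnorm : ∀ t, 0 ≤ t → ∀ p, tensorNorm X (g t) (h t - g t) p =
      √(defect (transition c₁ c₃ c₆) (sol m t) (sol l t)) := by
    intro t ht p
    have hcomp : comp (changeFrame (transition a₁ a₃ a₆) X) (h t - g t) p =
        transition c₁ c₃ c₆ * Matrix.diagonal (sol m t) * (transition c₁ c₃ c₆).transpose -
          Matrix.diagonal (sol l t) := by
      rw [← hg t ht p, ← hh t ht p, ← comp_changeFrame, ← changeFrame_mul, hc]
      rfl
    rw [← tensorNorm_changeFrame (L := transition a₁ a₃ a₆) (by simp [det_transition]),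
      tensorNorm_of_comp_eq_diagonal
        (fun i => ((isDiagSol_sol hl).pos t ht i).ne') (hg t ht p), hcomp]
    rfl
  have hlim := (tendsto_defect hm hl c₁ c₃ c₆).sqrt
  have hq : QuasiConverges X h g ↔ Tendsto
      (fun t => √(defect (transition c₁ c₃ c₆) (sol m t) (sol l t))) atTop (𝓝 0) := by
    rw [Metric.tendsto_atTop]
    refine forall₂_congr fun ε _ => ⟨?_, ?_⟩
    · rintro ⟨T, hT, H⟩
      refine ⟨T, fun t ht => ?_⟩
      have := H t ht (Classical.arbitrary M)
      rw [hnorm t (hT.trans ht)] at this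
      rwa [Real.dist_0_eq_abs, abs_of_nonneg (Real.sqrt_nonneg _)]
    · rintro ⟨T, H⟩
      refine ⟨max T 0, le_max_right _ _, fun t ht p => ?_⟩
      have := H t ((le_max_left _ _).trans ht)
      rw [Real.dist_0_eq_abs, abs_of_nonneg (Real.sqrt_nonneg _)] at this
      rwa [hnorm t ((le_max_right _ _).trans ht)]
  rw [hq, ← sum_lead_eq_zero_iff (invK_pos hm) (invK_pos hl)]
  have hnn : 0 ≤ ∑ i, (lead (invK m) i - lead (invK l) i) ^ 2 / lead (invK l) i ^ 2 :=
    Finset.sum_nonneg fun i _ => by positivity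
  constructor
  · intro h0
    exact (Real.sqrt_eq_zero hnn).1 (tendsto_nhds_unique hlim h0)
  · intro h0
    rwa [h0, Real.sqrt_zero] at hlim

end RicciU3I0

end

theorem theorem8p1 {M : Type*} [TopologicalSpace M] [ChartedSpace (EuclideanSpace ℝ (Fin 4)) M]
    [IsManifold (𝓡 4) ∞ M] [Nonempty M]
    (X : Fin 4 → RicciU3I0.VField M) (hX : RicciU3I0.IsU3I0Frame X) :
    -- the flows exist for all times and are determined by the frame and the initial data
    (∀ (a₁ a₃ a₆ : ℝ) (l : Fin 4 → ℝ), (∀ i, 0 < l i) →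
      ∃ g : ℝ → RicciU3I0.TwoTensor M,
        RicciU3I0.IsDiagonalFlow
          (RicciU3I0.changeFrame (RicciU3I0.transition a₁ a₃ a₆) X) l g ∧
        ∀ g' : ℝ → RicciU3I0.TwoTensor M,
          RicciU3I0.IsDiagonalFlow
            (RicciU3I0.changeFrame (RicciU3I0.transition a₁ a₃ a₆) X) l g' →
          ∀ t ≥ 0, g' t = g t) ∧
    ∀ (a₁ a₃ a₆ : ℝ) (l : Fin 4 → ℝ) (g : ℝ → RicciU3I0.TwoTensor M),
      RicciU3I0.IsDiagonalFlow
        (RicciU3I0.changeFrame (RicciU3I0.transition a₁ a₃ a₆) X) l g →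
      -- the characterization of the class of `g`
      (∀ (b₁ b₃ b₆ : ℝ) (m : Fin 4 → ℝ) (h : ℝ → RicciU3I0.TwoTensor M),
        RicciU3I0.IsDiagonalFlow
          (RicciU3I0.changeFrame (RicciU3I0.transition b₁ b₃ b₆) X) m h →
        (RicciU3I0.QuasiConverges X h g ↔
          m 1 * m 2 * m 3 ^ 2 = l 1 * l 2 * l 3 ^ 2)) ∧
      -- in each frame, the initial data `m₁, m₂, m₄ > 0` are free parameters of the class
      -- of `g`, and they determine the member
      (∀ b₁ b₃ b₆ m₁ m₂ m₄ : ℝ, 0 < m₁ → 0 < m₂ → 0 < m₄ →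
        ∃ m₃ > 0, ∃ h : ℝ → RicciU3I0.TwoTensor M,
          RicciU3I0.IsDiagonalFlow
            (RicciU3I0.changeFrame (RicciU3I0.transition b₁ b₃ b₆) X) ![m₁, m₂, m₃, m₄] h ∧
          RicciU3I0.QuasiConverges X h g ∧
          ∀ (m₃' : ℝ) (h' : ℝ → RicciU3I0.TwoTensor M),
            RicciU3I0.IsDiagonalFlow
              (RicciU3I0.changeFrame (RicciU3I0.transition b₁ b₃ b₆) X) ![m₁, m₂, m₃', m₄] h' →
            RicciU3I0.QuasiConverges X h' g →
            m₃' = m₃ ∧ ∀ t ≥ 0, h' t = h t) := by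
  refine ⟨fun a₁ a₃ a₆ l hl => ?_, fun a₁ a₃ a₆ l g hg => ⟨fun b₁ b₃ b₆ m h hh =>
    RicciU3I0.quasiConverges_iff hX hg hh, fun b₁ b₃ b₆ m₁ m₂ m₄ h1 h2 h4 => ?_⟩⟩
  · have hY := hX.changeFrame_transition a₁ a₃ a₆
    obtain ⟨g, hg⟩ := RicciU3I0.exists_isDiagonalFlow hY hl
    exact ⟨g, hg, fun g' hg' t ht => hg.unique hY hg' ht⟩
  · have hY := hX.changeFrame_transition b₁ b₃ b₆
    have hK := RicciU3I0.invK_pos (hg.comp_eq (hX.changeFrame_transition a₁ a₃ a₆)).1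
    obtain ⟨h, hh⟩ := RicciU3I0.exists_isDiagonalFlow hY
      (l := ![m₁, m₂, RicciU3I0.invK l / (m₂ * m₄ ^ 2), m₄])
      (fun i => by fin_cases i <;> simp <;> positivity)
    refine ⟨RicciU3I0.invK l / (m₂ * m₄ ^ 2), by positivity, h, hh,
      (RicciU3I0.quasiConverges_iff hX hg hh).2 ?_, fun m₃' h' hh' hq => ?_⟩
    · simp [RicciU3I0.invK]
      field_simp
    · have hm : m₃' = RicciU3I0.invK l / (m₂ * m₄ ^ 2) := by
        have := (RicciU3I0.quasiConverges_iff hX hg hh').1 hq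
        rw [← this]
        simp [RicciU3I0.invK]
        field_simp
      subst hm
      exact ⟨rfl, fun t ht => hh.unique hY hh' ht⟩
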